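/- **Theorem.** Let $\mu : 2^{[n]} \to \mathbb{R}_{\ge 0}$ be a probability distribution on the subsets of $[n]=\{1,\dots,n\}$, with generating polynomial $g_\mu(x)=\sum_{S\subseteq[n]}\mu(S)\prod_{i\in S}x_i$. Let $d\ge 1$. Assume that $\mu$ is $d$-homogeneous, i.e. $g_\mu$ is homogeneous of degree $d$, and strongly log-concave, i.e. every iterated partial derivative $p=\partial_{i_1}\cdots\partial_{i_k}g_\mu$ ($k\ge 0$) is either $0$ or log-concave at the all-ones vector $\mathbb 1$, meaning that the Hessian $\nabla^2\log p=\bigl(p\,\nabla^2p-(\nabla p)(\nabla p)^{\mathsf T}\bigr)/p^2$ is negative semidefinite at $\mathbb 1$. Let $P_\mu$ be the transition matrix of the following down-up chain $\mathcal M_\mu$ on $\operatorname{supp}(\mu)=\{S : \mu(S)\ne 0\}$: from $\tau$, drop a uniformly random element $i\in\tau$, then move to a set $\sigma\supseteq\tau\setminus\{i\}$ in $\operatorname{supp}(\mu)$ chosen with probability proportional to $\mu(\sigma)$. Let $X(k)$ be the collection of size-$k$ subsets of $[n]$ contained in some element of $\operatorname{supp}(\mu)$. Then: 1. All eigenvalues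 of $P_\mu$ are real and, for every $0\le k\le d-1$, at most $|X(k)|\le\binom nk$ of them (counted with multiplicity) are greater than $1-\frac{k+1}{d}$. 2. $\mathcal M_\mu$ has spectral gap at least $1/d$: if $1=\lambda_1\ge\lambda_2\ge\dots\ge\lambda_N$ are the eigenvalues of $P_\mu$, then $1-\lambda^*\ge\frac1d$, where $\lambda^*=\max_{j\ge 2}|\lambda_j|$ (and $\lambda^*=0$ if $N=1$). 3. For every $\tau\in\operatorname{supp}(\mu)$ and $0<\epsilon<1$, the mixing time $t_\tau(\epsilon)=\min\{t\in\mathbb Z_{\ge0} : \|P_\mu^t(\tau,\cdot)-\mu\|_1\le\epsilon\}$ exists and satisfies $$t_\tau(\epsilon)\le\left\lceil d\log\frac{1}{\epsilon\,\mu(\tau)}\right\rceil,$$ and if $d\ge 2$ then moreover $t_\tau(\epsilon)\le d\log\frac{1}{\epsilon\,\mu(\tau)}$. -/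

import Mathlib

open scoped BigOperators

/-- `μ` is a probability distribution on the subsets of `{1, …, n}`. -/
def IsDistribution {n : ℕ} (μ : Finset (Fin n) → ℝ) : Prop :=
  (∀ S, 0 ≤ μ S) ∧ ∑ S, μ S = 1

/-- The generating polynomial `g_μ(x) = ∑_S μ(S) ∏_{i ∈ S} x_i`. -/
noncomputable def genPoly {n : ℕ} (μ : Finset (Fin n) → ℝ) : MvPolynomial (Fin n) ℝ :=
  ∑ S, MvPolynomial.C (μ S) * ∏ i ∈ S, MvPolynomial.X i

/-- The Hessian matrix of `log p` at the point `x`, namely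
`(p ∇²p - (∇p)(∇p)ᵀ) / p²` evaluated at `x` (meaningful where `p(x) > 0`). -/
noncomputable def hessianLog {n : ℕ} (p : MvPolynomial (Fin n) ℝ) (x : Fin n → ℝ) :
    Matrix (Fin n) (Fin n) ℝ :=
  Matrix.of fun i j =>
    (MvPolynomial.eval x p *
        MvPolynomial.eval x (MvPolynomial.pderiv i (MvPolynomial.pderiv j p)) -
      MvPolynomial.eval x (MvPolynomial.pderiv i p) *
        MvPolynomial.eval x (MvPolynomial.pderiv j p)) /
      (MvPolynomial.eval x p) ^ 2

/-- A polynomial `p` (with nonnegative coefficients) is log-concave at `x` if the Hessian of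
`log p` at `x` is negative semidefinite; the zero polynomial is log-concave by convention. -/
def LogConcaveAt {n : ℕ} (p : MvPolynomial (Fin n) ℝ) (x : Fin n → ℝ) : Prop :=
  p = 0 ∨ ∀ v : Fin n → ℝ, v ⬝ᵥ ((hessianLog p x).mulVec v) ≤ 0

/-- `p` is strongly log-concave (at the all-ones vector): all its iterated partial derivatives
`∂_{i₁} ⋯ ∂_{i_k} p`, including `p` itself (`k = 0`), are log-concave at the all-ones vector. -/
def StronglyLogConcave {n : ℕ} (p : MvPolynomial (Fin n) ℝ) : Prop :=
  ∀ l : List (Fin n), LogConcaveAt (l.foldr (fun i q => MvPolynomial.pderiv i q) p) 1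

/-- The support of `μ`, which is the state space of the chain. -/
noncomputable def supp {n : ℕ} (μ : Finset (Fin n) → ℝ) : Finset (Finset (Fin n)) :=
  Finset.univ.filter fun S => μ S ≠ 0

/-- `X(k)`: the size-`k` subsets of the ground set contained in some element of `supp μ`. -/
noncomputable def faces {n : ℕ} (μ : Finset (Fin n) → ℝ) (k : ℕ) : Finset (Finset (Fin n)) :=
  Finset.univ.filter fun T => T.card = k ∧ ∃ S ∈ supp μ, T ⊆ S

/-- The transition matrix of the down-up chain `M_μ`: from `τ`, drop a uniformly random `i ∈ τ`,
then move to a set `σ ⊇ τ \ {i}` of the support, chosen with probability proportional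
to `μ σ`. -/
noncomputable def downUp {n : ℕ} (μ : Finset (Fin n) → ℝ) :
    Matrix (supp μ) (supp μ) ℝ :=
  Matrix.of fun τ σ =>
    ∑ i ∈ τ.1, (1 / (τ.1.card : ℝ)) *
      (if τ.1.erase i ⊆ σ.1 then
        μ σ.1 / ∑ ρ ∈ (supp μ).filter (fun ρ => τ.1.erase i ⊆ ρ), μ ρ
      else 0)

/-- The real eigenvalues of a matrix, listed with algebraic multiplicity. -/
noncomputable def eigenvalueMultiset {Ω : Type*} [Fintype Ω] [DecidableEq Ω]
    (P : Matrix Ω Ω ℝ) : Multiset ℝ :=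
  P.charpoly.roots

/-- For a transition matrix `P` with real eigenvalues `1 = λ₁ ≥ λ₂ ≥ … ≥ λ_N`:
the largest absolute value among `λ₂, …, λ_N` (one copy of the eigenvalue `1` is removed),
and `0` when there is only one state. -/
noncomputable def lambdaStar {Ω : Type*} [Fintype Ω] [DecidableEq Ω]
    (P : Matrix Ω Ω ℝ) : ℝ :=
  (((eigenvalueMultiset P).erase 1).map (fun x => |x|)).fold max 0

/-- The (absolute) spectral gap `1 - λ*`. -/
noncomputable def spectralGap {Ω : Type*} [Fintype Ω] [DecidableEq Ω]
    (P : Matrix Ω Ω ℝ) : ℝ :=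
  1 - lambdaStar P

/-- `T` is the mixing time `t_τ(ε)` of the chain with transition matrix `P` and stationary
distribution `π`: the minimum `t ≥ 0` with `‖P^t(τ, ·) - π‖₁ ≤ ε` (in particular, such a `t`
exists). -/
def IsMixingTime {Ω : Type*} [Fintype Ω] [DecidableEq Ω]
    (P : Matrix Ω Ω ℝ) (π : Ω → ℝ) (τ : Ω) (ε : ℝ) (T : ℕ) : Prop :=
  IsLeast {t : ℕ | ∑ σ, |(P ^ t) τ σ - π σ| ≤ ε} T

/-! Write w(T) = `upWeight μ T` for the mass above T. For a function f on the support let g(T) be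
its μ-average over the sets containing T (`upAverage`), and let N_k = `levelNorm` be the squared
w-norm of g on sets of size k. Then N_d is the squared μ-norm of f, and the quadratic form of the
chain is N_{d-1}/d. So the chain is positive semidefinite, and spectral bounds amount to comparing
N_{d-1} with N_d. The derivative of g_μ along T has value, gradient and Hessian at the all-ones
vector given by w at T, T∪{i} and T∪{i,j}. Log-concavity makes this Hessian nonpositive on vectors
orthogonal to the gradient. Testing it on v_i = g(T∪{i}) - g(T) (`local_pair_le`) and summing over T
bounds the norm L_{k+2} (`liftNorm`) of the facet sums of g: L_{k+2} ≤ (d-k-1)(N_{k+1} + (d-k)N_k).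
Taking facet sums is adjoint to averaging up to a scalar, so Cauchy-Schwarz turns a bound on L_{k+1}
into (d-k)N_k ≤ c N_{k+1}. If g vanishes on level i, alternating the two estimates upwards gives c =
m at level i+m (`levelNorm_contract`), hence contraction by (d-1-i)/d at the top
(`downUp_contract`). Vanishing on level k imposes at most |X(k)| linear conditions, so a dimension
count bounds the number of large eigenvalues. The case i = 0 is contraction of mean-zero functions;
it gives the gap, and an L² estimate then gives the mixing time. -/

/-- The total mass of the sets containing `T`. -/
noncomputable def upWeight {n : ℕ} (μ : Finset (Fin n) → ℝ) (T : Finset (Fin n)) : ℝ :=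
  ∑ S, if T ⊆ S then μ S else 0

/-- The coefficient function of the iterated derivative of `genPoly μ` in the directions of `T`. -/
def linkFun {n : ℕ} (μ : Finset (Fin n) → ℝ) (T : Finset (Fin n)) : Finset (Fin n) → ℝ :=
  fun S => if Disjoint T S then μ (T ∪ S) else 0

/-! ### Derivatives of the generating polynomial at the all-ones vector. -/

section GeneratingPolynomial

variable {n : ℕ}

theorem pderiv_prod_X (i : Fin n) (S : Finset (Fin n)) :
    MvPolynomial.pderiv i (∏ j ∈ S, (MvPolynomial.X j : MvPolynomial (Fin n) ℝ)) =
      if i ∈ S then ∏ j ∈ S.erase i, MvPolynomial.X j else 0 := by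
  classical
  induction S using Finset.induction_on with
  | empty => simp
  | insert a S ha ih =>
    rw [Finset.prod_insert ha, MvPolynomial.pderiv_mul, ih, MvPolynomial.pderiv_X]
    by_cases hia : i = a
    · subst hia
      simp [ha]
    · have hai : a ≠ i := Ne.symm hia
      by_cases hi : i ∈ S
      · rw [Finset.erase_insert_of_ne hai, Finset.prod_insert (by simp [ha])]
        simp [hi, hia]
      · simp [hi, hia]

theorem pderiv_genPoly (i : Fin n) (μ : Finset (Fin n) → ℝ) :
    MvPolynomial.pderiv i (genPoly μ) = genPoly (linkFun μ {i}) := by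
  classical
  have h1 : MvPolynomial.pderiv i (genPoly μ) = ∑ S ∈ Finset.univ.filter (fun S => i ∈ S),
      MvPolynomial.C (μ S) * ∏ j ∈ S.erase i, MvPolynomial.X j := by
    rw [genPoly, map_sum, Finset.sum_filter]
    refine Finset.sum_congr rfl fun S _ => ?_
    rw [MvPolynomial.pderiv_mul, MvPolynomial.pderiv_C, pderiv_prod_X]
    split_ifs <;> simp
  have h2 : genPoly (linkFun μ {i}) = ∑ S ∈ Finset.univ.filter (fun S => i ∉ S),
      MvPolynomial.C (μ (insert i S)) * ∏ j ∈ S, MvPolynomial.X j := by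
    rw [genPoly, Finset.sum_filter]
    refine Finset.sum_congr rfl fun S _ => ?_
    by_cases h : i ∈ S <;> simp [linkFun, h]
  rw [h1, h2]
  refine Finset.sum_bij' (fun S _ => S.erase i) (fun S _ => insert i S) ?_ ?_ ?_ ?_ ?_
  · intro S hS; simp
  · intro S hS; simp
  · intro S hS; exact Finset.insert_erase (by simpa using hS)
  · intro S hS; exact Finset.erase_insert (by simpa using hS)
  · intro S hS; rw [Finset.insert_erase (by simpa using hS)]

theorem linkFun_linkFun_of_notMem (μ : Finset (Fin n) → ℝ) {T : Finset (Fin n)} {i : Fin n}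
    (hi : i ∉ T) : linkFun (linkFun μ T) {i} = linkFun μ (insert i T) := by
  funext S
  by_cases h : i ∈ S
  · simp [linkFun, h]
  · simp [linkFun, h, hi]

theorem linkFun_linkFun_of_mem (μ : Finset (Fin n) → ℝ) {T : Finset (Fin n)} {i : Fin n}
    (hi : i ∈ T) : linkFun (linkFun μ T) {i} = 0 := by
  funext S
  by_cases h : i ∈ S <;> simp [linkFun, h, hi]

theorem genPoly_zero : genPoly (0 : Finset (Fin n) → ℝ) = 0 := by
  simp [genPoly]

theorem sum_linkFun (μ : Finset (Fin n) → ℝ) (T : Finset (Fin n)) :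
    ∑ S, linkFun μ T S = upWeight μ T := by
  classical
  simp only [linkFun, upWeight]
  rw [← Finset.sum_filter, ← Finset.sum_filter]
  refine Finset.sum_bij' (fun S _ => T ∪ S) (fun S _ => S \ T) ?_ ?_ ?_ ?_ ?_
  · intro S hS; simp
  · intro S hS; simp [Finset.disjoint_sdiff]
  · intro S hS
    have : Disjoint T S := by simpa using hS
    rw [Finset.union_sdiff_left, Finset.sdiff_eq_self_of_disjoint this.symm]
  · intro S hS
    exact Finset.union_sdiff_of_subset (by simpa using hS)
  · intro S hS; rfl

theorem eval_one_genPoly (μ : Finset (Fin n) → ℝ) :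
    MvPolynomial.eval 1 (genPoly μ) = ∑ S, μ S := by
  simp [genPoly]

/-- Lists without repetition suffice: the polynomial is affine in each variable, so a repeated
derivative vanishes. -/
theorem foldr_pderiv_genPoly (μ : Finset (Fin n) → ℝ) (l : List (Fin n)) (hl : l.Nodup) :
    l.foldr (fun i q => MvPolynomial.pderiv i q) (genPoly μ) = genPoly (linkFun μ l.toFinset) := by
  induction l with
  | nil =>
    simp only [List.foldr_nil, List.toFinset_nil]
    congr 1
    funext S
    simp [linkFun]
  | cons a l ih =>
    rw [List.nodup_cons] at hl
    rw [List.foldr_cons, ih hl.2, pderiv_genPoly, linkFun_linkFun_of_notMem _ (by simpa using hl.1),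
      List.toFinset_cons]

theorem eval_one_genPoly_linkFun (μ : Finset (Fin n) → ℝ) (T : Finset (Fin n)) :
    MvPolynomial.eval 1 (genPoly (linkFun μ T)) = upWeight μ T := by
  rw [eval_one_genPoly, sum_linkFun]

theorem eval_one_pderiv_linkFun (μ : Finset (Fin n) → ℝ) (T : Finset (Fin n)) (i : Fin n) :
    MvPolynomial.eval 1 (MvPolynomial.pderiv i (genPoly (linkFun μ T))) =
      if i ∈ T then 0 else upWeight μ (insert i T) := by
  rw [pderiv_genPoly]
  split_ifs with h
  · rw [linkFun_linkFun_of_mem _ h, genPoly_zero, map_zero]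
  · rw [linkFun_linkFun_of_notMem _ h, eval_one_genPoly_linkFun]

theorem eval_one_pderiv_pderiv_linkFun (μ : Finset (Fin n) → ℝ) (T : Finset (Fin n))
    (i j : Fin n) :
    MvPolynomial.eval 1 (MvPolynomial.pderiv i (MvPolynomial.pderiv j (genPoly (linkFun μ T)))) =
      if j ∈ T then 0 else if i ∈ insert j T then 0 else upWeight μ (insert i (insert j T)) := by
  rw [pderiv_genPoly j]
  by_cases h : j ∈ T
  · rw [linkFun_linkFun_of_mem _ h, genPoly_zero, map_zero, map_zero, if_pos h]
  · rw [linkFun_linkFun_of_notMem _ h, eval_one_pderiv_linkFun, if_neg h]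

/-- Distinct sets give distinct squarefree monomials, so μ(S) is itself a coefficient and nothing
cancels. -/
theorem card_eq_of_isHomogeneous {μ : Finset (Fin n) → ℝ} {d : ℕ}
    (h : (genPoly μ).IsHomogeneous d) {S : Finset (Fin n)} (hS : μ S ≠ 0) : S.card = d := by
  classical
  let e : Finset (Fin n) → (Fin n →₀ ℕ) := fun S => ∑ i ∈ S, Finsupp.single i 1
  have he : ∀ (S : Finset (Fin n)) i, e S i = if i ∈ S then 1 else 0 := by
    intro S i
    simp [e, Finsupp.finsetSum_apply, Finsupp.single_apply]
  have hinj : ∀ S T, e S = e T → S = T := by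
    intro S T hST
    ext i
    have := DFunLike.congr_fun hST i
    rw [he, he] at this
    by_cases h1 : i ∈ S <;> by_cases h2 : i ∈ T <;> simp_all
  have hprod : ∀ S : Finset (Fin n), ∏ i ∈ S, (MvPolynomial.X i : MvPolynomial (Fin n) ℝ) =
      MvPolynomial.monomial (e S) 1 := by
    intro S
    simp only [e, MvPolynomial.monomial_sum_one, MvPolynomial.X]
  have hcoeff : MvPolynomial.coeff (e S) (genPoly μ) = μ S := by
    rw [genPoly, MvPolynomial.coeff_sum, Finset.sum_eq_single S]
    · rw [hprod, MvPolynomial.coeff_C_mul, MvPolynomial.coeff_monomial]; simp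
    · intro T _ hT
      rw [hprod, MvPolynomial.coeff_C_mul, MvPolynomial.coeff_monomial,
        if_neg (fun h => hT (hinj _ _ h)), mul_zero]
    · simp
  have := h (d := e S) (by rw [hcoeff]; exact hS)
  rw [← this]
  simp [e, map_sum, Finsupp.weight_single]

end GeneratingPolynomial

/-! ### Masses above a set, and log-concavity in terms of them. -/

section UpWeight

variable {n : ℕ}

theorem upWeight_nonneg {μ : Finset (Fin n) → ℝ} (h : ∀ S, 0 ≤ μ S) (T : Finset (Fin n)) :
    0 ≤ upWeight μ T :=
  Finset.sum_nonneg fun S _ => by split_ifs <;> simp [h]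

/-- Ensures that weight times average recovers the weighted sum even where the average is a division
by zero. -/
theorem upWeight_mul_eq_zero {μ : Finset (Fin n) → ℝ} (h : ∀ S, 0 ≤ μ S) (f : Finset (Fin n) → ℝ)
    {T : Finset (Fin n)} (hT : upWeight μ T = 0) : upWeight (fun S => μ S * f S) T = 0 := by
  have h0 := (Finset.sum_eq_zero_iff_of_nonneg
    (fun S _ => by split_ifs <;> simp [h])).1 hT
  refine Finset.sum_eq_zero fun S hS => ?_
  have := h0 S hS
  split_ifs at this ⊢ <;> simp_all

/-- Each S ⊇ T is counted once for every element of S \ T. Signs are not restricted, so this applies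
to μ·f as well as to μ. -/
theorem sum_upWeight_insert {ν : Finset (Fin n) → ℝ} {d : ℕ} (h : ∀ S, ν S ≠ 0 → S.card = d)
    (T : Finset (Fin n)) :
    ∑ i ∈ Tᶜ, upWeight ν (insert i T) = ((d : ℝ) - T.card) * upWeight ν T := by
  unfold upWeight
  rw [Finset.sum_comm, Finset.mul_sum]
  refine Finset.sum_congr rfl fun S _ => ?_
  by_cases hS : ν S = 0
  · simp [hS]
  by_cases hT : T ⊆ S
  · rw [if_pos hT, ← Finset.sum_filter, Finset.sum_const, nsmul_eq_mul]
    have : Tᶜ.filter (fun i => insert i T ⊆ S) = S \ T := by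
      ext i
      simp only [Finset.mem_filter, Finset.mem_compl, Finset.mem_sdiff, Finset.insert_subset_iff]
      tauto
    rw [this, Finset.cast_card_sdiff hT, h S hS]
  · rw [if_neg hT, mul_zero]
    refine Finset.sum_eq_zero fun i _ => if_neg fun hi => hT ?_
    exact (Finset.subset_insert i T).trans hi

theorem upWeight_eq_self {ν : Finset (Fin n) → ℝ} {d : ℕ} (h : ∀ S, ν S ≠ 0 → S.card = d)
    {T : Finset (Fin n)} (hT : T.card = d) : upWeight ν T = ν T := by
  unfold upWeight
  rw [Finset.sum_eq_single T]
  · simp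
  · intro S _ hS
    split_ifs with hTS
    · by_contra h0
      exact hS (Finset.eq_of_subset_of_card_le hTS (by rw [h S h0, hT])).symm
    · rfl
  · simp

/-- The Hessian condition for the derivative along T with the denominator cleared; when the mass
above T is zero the left side vanishes. -/
theorem logConcave_upWeight {μ : Finset (Fin n) → ℝ} (h : ∀ S, 0 ≤ μ S)
    (hslc : StronglyLogConcave (genPoly μ)) (T : Finset (Fin n)) (v : Fin n → ℝ) :
    upWeight μ T * ∑ i ∈ Tᶜ, ∑ j ∈ (insert i T)ᶜ,
        upWeight μ (insert j (insert i T)) * (v i * v j) ≤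
      (∑ i ∈ Tᶜ, upWeight μ (insert i T) * v i) ^ 2 := by
  classical
  by_cases hw : upWeight μ T = 0
  · rw [hw, zero_mul]; positivity
  have hpos : 0 < upWeight μ T := lt_of_le_of_ne (upWeight_nonneg h T) (Ne.symm hw)
  have key := hslc T.toList
  rw [foldr_pderiv_genPoly μ _ T.nodup_toList, Finset.toList_toFinset] at key
  rcases key with key | key
  · exact absurd (by rw [← eval_one_genPoly_linkFun, key, map_zero]) hw
  have key := key v
  have e : v ⬝ᵥ ((hessianLog (genPoly (linkFun μ T)) 1).mulVec v) =
      (upWeight μ T * ∑ i ∈ Tᶜ, ∑ j ∈ (insert i T)ᶜ,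
        upWeight μ (insert j (insert i T)) * (v i * v j) -
      (∑ i ∈ Tᶜ, upWeight μ (insert i T) * v i) ^ 2) / upWeight μ T ^ 2 := by
    have c1 : ∀ φ : Fin n → ℝ, ∑ i ∈ Tᶜ, φ i = ∑ i, if i ∈ T then 0 else φ i := by
      intro φ
      rw [Finset.compl_eq_univ_sdiff, Finset.sdiff_eq_filter, Finset.sum_filter]
      exact Finset.sum_congr rfl fun i _ => by by_cases hi : i ∈ T <;> simp [hi]
    have c2 : ∀ i, ∀ φ : Fin n → ℝ,
        ∑ j ∈ (insert i T)ᶜ, φ j = ∑ j, if j ∈ insert i T then 0 else φ j := by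
      intro i φ
      rw [Finset.compl_eq_univ_sdiff, Finset.sdiff_eq_filter, Finset.sum_filter]
      exact Finset.sum_congr rfl fun j _ => by
        by_cases hj : j ∈ insert i T <;> simp only [hj] <;> simp
    simp only [dotProduct, Matrix.mulVec, hessianLog, Matrix.of_apply,
      eval_one_genPoly_linkFun, eval_one_pderiv_linkFun, eval_one_pderiv_pderiv_linkFun]
    have sw : ∀ i j, (if j ∈ T then (0 : ℝ) else if i ∈ insert j T then 0
        else upWeight μ (insert i (insert j T))) = if i ∈ T then (0 : ℝ) else
        if j ∈ insert i T then 0 else upWeight μ (insert j (insert i T)) := by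
      intro i j
      by_cases hij : i = j
      · subst hij; rfl
      · by_cases hi : i ∈ T <;> by_cases hj : j ∈ T <;>
          simp [hi, hj, hij, Ne.symm hij, Finset.insert_comm i j]
    rw [eq_div_iff (by positivity), sq (∑ i ∈ Tᶜ, _), c1, c1, Finset.sum_mul_sum,
      Finset.mul_sum, ← Finset.sum_sub_distrib, Finset.sum_mul]
    refine Finset.sum_congr rfl fun i _ => ?_
    have c3 : (if i ∈ T then (0 : ℝ) else ∑ j ∈ (insert i T)ᶜ,
        upWeight μ (insert j (insert i T)) * (v i * v j)) =
        ∑ j, (if i ∈ T then (0 : ℝ) else if j ∈ insert i T then 0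
          else upWeight μ (insert j (insert i T))) * (v i * v j) := by
      by_cases hi : i ∈ T
      · simp [hi]
      · rw [if_neg hi, c2]
        refine Finset.sum_congr rfl fun j _ => ?_
        rw [if_neg hi, ite_mul, zero_mul]
    rw [c3, Finset.mul_sum, Finset.mul_sum, Finset.sum_mul, ← Finset.sum_sub_distrib]
    refine Finset.sum_congr rfl fun j _ => ?_
    rw [sw]
    have c4 : ∀ k, (if k ∈ T then (0 : ℝ) else upWeight μ (insert k T) * v k) =
      (if k ∈ T then (0 : ℝ) else upWeight μ (insert k T)) * v k := fun k => by
      rw [ite_mul, zero_mul]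
    rw [c4, c4]
    field_simp
  rw [e] at key
  have := (div_le_iff₀ (by positivity)).1 key
  linarith

end UpWeight

/-! ### Norms on consecutive levels and their comparison. -/

section Levels

variable {n : ℕ}

theorem sum_powersetCard_succ (k : ℕ) (φ : Finset (Fin n) → Fin n → ℝ) :
    ∑ U ∈ Finset.powersetCard (k + 1) Finset.univ, ∑ i ∈ U, φ U i =
      ∑ T ∈ Finset.powersetCard k Finset.univ, ∑ i ∈ Tᶜ, φ (insert i T) i := by
  classical
  rw [Finset.sum_sigma', Finset.sum_sigma']
  refine Finset.sum_bij' (fun p _ => ⟨p.1.erase p.2, p.2⟩) (fun p _ => ⟨insert p.2 p.1, p.2⟩)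
    ?_ ?_ ?_ ?_ ?_
  · rintro ⟨U, i⟩ h
    simp only [Finset.mem_sigma, Finset.mem_powersetCard_univ] at h
    simp [h.1, Finset.card_erase_of_mem h.2]
  · rintro ⟨T, i⟩ h
    simp only [Finset.mem_sigma, Finset.mem_powersetCard_univ, Finset.mem_compl] at h
    simp [h.1, Finset.card_insert_of_notMem h.2]
  · rintro ⟨U, i⟩ h
    simp only [Finset.mem_sigma] at h
    simp [Finset.insert_erase h.2]
  · rintro ⟨T, i⟩ h
    simp only [Finset.mem_sigma, Finset.mem_compl] at h
    simp [Finset.erase_insert h.2]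
  · rintro ⟨U, i⟩ h
    simp only [Finset.mem_sigma] at h
    simp [Finset.insert_erase h.2]

/-- The squared norm of `g` on the sets of size `k`, weighted by `w`. -/
noncomputable def levelNorm (w g : Finset (Fin n) → ℝ) (k : ℕ) : ℝ :=
  ∑ T ∈ Finset.powersetCard k Finset.univ, w T * g T ^ 2

/-- The squared norm, on the sets of size `k`, of the function summing `g` over the facets. -/
noncomputable def liftNorm (w g : Finset (Fin n) → ℝ) (k : ℕ) : ℝ :=
  ∑ U ∈ Finset.powersetCard k Finset.univ, w U * (∑ i ∈ U, g (U.erase i)) ^ 2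

theorem levelNorm_nonneg {w : Finset (Fin n) → ℝ} (hw : ∀ T, 0 ≤ w T) (g : Finset (Fin n) → ℝ)
    (k : ℕ) : 0 ≤ levelNorm w g k :=
  Finset.sum_nonneg fun T _ => mul_nonneg (hw T) (sq_nonneg _)

/-- Expand the square: diagonal terms regroup by the facet U \ {i}, and off-diagonal ones by the set
left after deleting both i and j. -/
theorem liftNorm_eq {w g : Finset (Fin n) → ℝ} {d : ℕ}
    (hsum : ∀ T : Finset (Fin n), ∑ i ∈ Tᶜ, w (insert i T) = ((d : ℝ) - T.card) * w T) (k : ℕ) :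
    liftNorm w g (k + 2) = ((d : ℝ) - (k + 1)) * levelNorm w g (k + 1) +
      ∑ T ∈ Finset.powersetCard k Finset.univ, ∑ i ∈ Tᶜ, ∑ j ∈ (insert i T)ᶜ,
        w (insert j (insert i T)) * (g (insert i T) * g (insert j T)) := by
  classical
  have h1 : liftNorm w g (k + 2) = ∑ U ∈ Finset.powersetCard (k + 2) Finset.univ, ∑ i ∈ U,
      (w U * g (U.erase i) ^ 2 +
        ∑ j ∈ U.erase i, w U * (g (U.erase i) * g (U.erase j))) := by
    refine Finset.sum_congr rfl fun U _ => ?_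
    rw [sq, Finset.sum_mul_sum, Finset.mul_sum]
    refine Finset.sum_congr rfl fun i hi => ?_
    rw [← Finset.add_sum_erase _ _ hi, mul_add, Finset.mul_sum, sq]
  have h2 : levelNorm w g (k + 1) * ((d : ℝ) - (k + 1)) =
      ∑ S ∈ Finset.powersetCard (k + 1) Finset.univ, ∑ i ∈ Sᶜ,
        w (insert i S) * g S ^ 2 := by
    rw [levelNorm, Finset.sum_mul]
    refine Finset.sum_congr rfl fun S hS => ?_
    rw [← Finset.sum_mul, hsum, (Finset.mem_powersetCard_univ.1 hS)]
    push_cast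
    ring
  rw [h1, sum_powersetCard_succ, mul_comm, h2]
  have h3 : ∀ S ∈ Finset.powersetCard (k + 1) (Finset.univ : Finset (Fin n)), ∀ i ∈ Sᶜ,
      (w (insert i S) * g ((insert i S).erase i) ^ 2 + ∑ j ∈ (insert i S).erase i,
        w (insert i S) * (g ((insert i S).erase i) * g ((insert i S).erase j))) =
      w (insert i S) * g S ^ 2 + ∑ j ∈ S, w (insert i S) * (g S * g ((insert i S).erase j)) := by
    intro S _ i hi
    rw [Finset.erase_insert (Finset.mem_compl.1 hi)]
  rw [Finset.sum_congr rfl fun S hS => Finset.sum_congr rfl (h3 S hS)]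
  simp only [Finset.sum_add_distrib]
  congr 1
  rw [Finset.sum_congr rfl fun S _ => Finset.sum_comm, sum_powersetCard_succ]
  refine Finset.sum_congr rfl fun T _ => Finset.sum_congr rfl fun i hi =>
    Finset.sum_congr rfl fun j hj => ?_
  have hij : i ≠ j := by rintro rfl; simp at hj
  rw [Finset.insert_comm j i, Finset.erase_insert]
  simp only [Finset.mem_insert, not_or]
  simp only [Finset.mem_compl, Finset.mem_insert, not_or] at hi hj
  exact ⟨hij, hi⟩

/-- Adjointness of facet sums and averaging: summing w·g over all supersets one larger gives back a
multiple of w·g. -/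
theorem levelNorm_pairing {w F g : Finset (Fin n) → ℝ} {d : ℕ} (hg : ∀ T, w T * g T = F T)
    (hF : ∀ T : Finset (Fin n), ∑ i ∈ Tᶜ, F (insert i T) = ((d : ℝ) - T.card) * F T) (k : ℕ) :
    ∑ U ∈ Finset.powersetCard (k + 1) Finset.univ, w U * (g U * ∑ i ∈ U, g (U.erase i)) =
      ((d : ℝ) - k) * levelNorm w g k := by
  classical
  have : ∑ U ∈ Finset.powersetCard (k + 1) Finset.univ, w U * (g U * ∑ i ∈ U, g (U.erase i)) =
      ∑ U ∈ Finset.powersetCard (k + 1) Finset.univ, ∑ i ∈ U, F U * g (U.erase i) :=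
    Finset.sum_congr rfl fun U _ => by rw [← mul_assoc, hg, Finset.mul_sum]
  rw [this, sum_powersetCard_succ, levelNorm, Finset.mul_sum]
  refine Finset.sum_congr rfl fun T hT => ?_
  rw [Finset.sum_congr rfl fun i hi => by rw [Finset.erase_insert (Finset.mem_compl.1 hi)],
    ← Finset.sum_mul, hF, Finset.mem_powersetCard_univ.1 hT, ← hg]
  ring

/-- The local inequality coming from log-concavity, at a set `T` of size at most `d - 2`. -/
theorem local_pair_le {w F g : Finset (Fin n) → ℝ} {d : ℕ} (hw : ∀ T, 0 ≤ w T)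
    (hsum : ∀ T : Finset (Fin n), ∑ i ∈ Tᶜ, w (insert i T) = ((d : ℝ) - T.card) * w T)
    (hg : ∀ T, w T * g T = F T)
    (hF : ∀ T : Finset (Fin n), ∑ i ∈ Tᶜ, F (insert i T) = ((d : ℝ) - T.card) * F T)
    (hlc : ∀ (T : Finset (Fin n)) (v : Fin n → ℝ),
      w T * ∑ i ∈ Tᶜ, ∑ j ∈ (insert i T)ᶜ, w (insert j (insert i T)) * (v i * v j) ≤
        (∑ i ∈ Tᶜ, w (insert i T) * v i) ^ 2) (T : Finset (Fin n)) :
    ∑ i ∈ Tᶜ, ∑ j ∈ (insert i T)ᶜ, w (insert j (insert i T)) * (g (insert i T) * g (insert j T)) ≤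
      ((d : ℝ) - T.card) * ((d : ℝ) - (T.card + 1)) * (w T * g T ^ 2) := by
  classical
  have hrow : ∀ i ∈ Tᶜ, ∑ j ∈ (insert i T)ᶜ, w (insert j (insert i T)) =
      ((d : ℝ) - (T.card + 1)) * w (insert i T) := by
    intro i hi
    rw [hsum, Finset.card_insert_of_notMem (Finset.mem_compl.1 hi)]
    push_cast
    ring
  -- Zero weight at T propagates to both levels above, so every term vanishes.
  by_cases h0 : w T = 0
  · have hz : ∀ i ∈ Tᶜ, w (insert i T) = 0 :=
      (Finset.sum_eq_zero_iff_of_nonneg fun i _ => hw _).1 (by rw [hsum, h0, mul_zero])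
    have hz2 : ∀ i ∈ Tᶜ, ∀ j ∈ (insert i T)ᶜ, w (insert j (insert i T)) = 0 := fun i hi =>
      (Finset.sum_eq_zero_iff_of_nonneg fun j _ => hw _).1 (by rw [hrow i hi, hz i hi, mul_zero])
    rw [h0, zero_mul, mul_zero]
    refine le_of_eq (Finset.sum_eq_zero fun i hi => Finset.sum_eq_zero fun j hj => ?_)
    rw [hz2 i hi j hj, zero_mul]
  have hpos : 0 < w T := lt_of_le_of_ne (hw T) (Ne.symm h0)
  have swap : ∀ φ : Fin n → Fin n → ℝ, ∑ i ∈ Tᶜ, ∑ j ∈ (insert i T)ᶜ, φ i j =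
      ∑ j ∈ Tᶜ, ∑ i ∈ (insert j T)ᶜ, φ i j := fun φ =>
    Finset.sum_comm' fun i j => by
      simp only [Finset.mem_compl, Finset.mem_insert, not_or]
      constructor
      · rintro ⟨h1, h2, h3⟩; exact ⟨⟨Ne.symm h2, h1⟩, h3⟩
      · rintro ⟨⟨h1, h2⟩, h3⟩; exact ⟨h2, Ne.symm h1, h3⟩
  have hFsum : ∑ i ∈ Tᶜ, w (insert i T) * g (insert i T) = ((d : ℝ) - T.card) * (w T * g T) := by
    rw [Finset.sum_congr rfl fun i _ => hg (insert i T), hF, hg]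
  have hlin : ∑ i ∈ Tᶜ, ∑ j ∈ (insert i T)ᶜ, w (insert j (insert i T)) * g (insert i T) =
      ((d : ℝ) - (T.card + 1)) * (((d : ℝ) - T.card) * (w T * g T)) := by
    rw [← hFsum, Finset.mul_sum]
    refine Finset.sum_congr rfl fun i hi => ?_
    rw [← Finset.sum_mul, hrow i hi, mul_assoc]
  have hlin' : ∑ i ∈ Tᶜ, ∑ j ∈ (insert i T)ᶜ, w (insert j (insert i T)) * g (insert j T) =
      ((d : ℝ) - (T.card + 1)) * (((d : ℝ) - T.card) * (w T * g T)) := by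
    rw [swap, ← hlin]
    refine Finset.sum_congr rfl fun i hi => Finset.sum_congr rfl fun j hj => ?_
    rw [Finset.insert_comm]
  have hconst : ∑ i ∈ Tᶜ, ∑ j ∈ (insert i T)ᶜ, w (insert j (insert i T)) =
      ((d : ℝ) - (T.card + 1)) * (((d : ℝ) - T.card) * w T) := by
    rw [← hsum, Finset.mul_sum]
    exact Finset.sum_congr rfl hrow
  -- Subtracting g(T) makes the test vector orthogonal to the gradient, so the square on the right
  -- of the log-concavity inequality disappears.
  have key := hlc T fun i => g (insert i T) - g T
  have hz : ∑ i ∈ Tᶜ, w (insert i T) * (g (insert i T) - g T) = 0 := by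
    simp only [mul_sub, Finset.sum_sub_distrib]
    rw [hFsum, ← Finset.sum_mul, hsum]
    ring
  rw [hz] at key
  have key := nonpos_of_mul_nonpos_right (key.trans_eq (zero_pow two_ne_zero)) hpos
  have hexp : ∑ i ∈ Tᶜ, ∑ j ∈ (insert i T)ᶜ,
      w (insert j (insert i T)) * ((g (insert i T) - g T) * (g (insert j T) - g T)) =
      (∑ i ∈ Tᶜ, ∑ j ∈ (insert i T)ᶜ,
        w (insert j (insert i T)) * (g (insert i T) * g (insert j T))) -
      g T * (∑ i ∈ Tᶜ, ∑ j ∈ (insert i T)ᶜ, w (insert j (insert i T)) * g (insert i T)) -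
      g T * (∑ i ∈ Tᶜ, ∑ j ∈ (insert i T)ᶜ, w (insert j (insert i T)) * g (insert j T)) +
      g T ^ 2 * ∑ i ∈ Tᶜ, ∑ j ∈ (insert i T)ᶜ, w (insert j (insert i T)) := by
    simp only [Finset.mul_sum, ← Finset.sum_sub_distrib, ← Finset.sum_add_distrib]
    refine Finset.sum_congr rfl fun i hi => Finset.sum_congr rfl fun j hj => ?_
    ring
  rw [hexp, hlin, hlin', hconst] at key
  linarith [key]

theorem liftNorm_le {w F g : Finset (Fin n) → ℝ} {d : ℕ} (hw : ∀ T, 0 ≤ w T)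
    (hsum : ∀ T : Finset (Fin n), ∑ i ∈ Tᶜ, w (insert i T) = ((d : ℝ) - T.card) * w T)
    (hg : ∀ T, w T * g T = F T)
    (hF : ∀ T : Finset (Fin n), ∑ i ∈ Tᶜ, F (insert i T) = ((d : ℝ) - T.card) * F T)
    (hlc : ∀ (T : Finset (Fin n)) (v : Fin n → ℝ),
      w T * ∑ i ∈ Tᶜ, ∑ j ∈ (insert i T)ᶜ, w (insert j (insert i T)) * (v i * v j) ≤
        (∑ i ∈ Tᶜ, w (insert i T) * v i) ^ 2) (k : ℕ) :
    liftNorm w g (k + 2) ≤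
      ((d : ℝ) - (k + 1)) * (levelNorm w g (k + 1) + ((d : ℝ) - k) * levelNorm w g k) := by
  rw [liftNorm_eq hsum, mul_add]
  refine add_le_add le_rfl ?_
  rw [levelNorm, Finset.mul_sum, Finset.mul_sum]
  refine Finset.sum_le_sum fun T hT => ?_
  have := local_pair_le hw hsum hg hF hlc T
  rw [Finset.mem_powersetCard_univ.1 hT] at this
  exact this.trans (le_of_eq (by ring))

/-- Cauchy-Schwarz in `levelNorm_pairing`, followed by cancelling one factor (d-k)N_k when it is
nonzero. -/
theorem levelNorm_le_of_liftNorm_le {w F g : Finset (Fin n) → ℝ} {d : ℕ} (hw : ∀ T, 0 ≤ w T)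
    (hg : ∀ T, w T * g T = F T)
    (hF : ∀ T : Finset (Fin n), ∑ i ∈ Tᶜ, F (insert i T) = ((d : ℝ) - T.card) * F T)
    {k : ℕ} (hk : k < d) {c : ℝ} (hc : 0 ≤ c)
    (hle : liftNorm w g (k + 1) ≤ ((d : ℝ) - k) * c * levelNorm w g k) :
    ((d : ℝ) - k) * levelNorm w g k ≤ c * levelNorm w g (k + 1) := by
  have hd : (0 : ℝ) < (d : ℝ) - k := sub_pos.2 (by exact_mod_cast hk)
  have cs : (((d : ℝ) - k) * levelNorm w g k) ^ 2 ≤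
      levelNorm w g (k + 1) * liftNorm w g (k + 1) := by
    rw [← levelNorm_pairing hg hF k]
    exact Finset.sum_sq_le_sum_mul_sum_of_sq_le_mul _
      (fun U _ => mul_nonneg (hw U) (sq_nonneg _)) (fun U _ => mul_nonneg (hw U) (sq_nonneg _))
      (fun U _ => le_of_eq (by ring))
  have hB := levelNorm_nonneg hw g (k + 1)
  rcases (levelNorm_nonneg hw g k).eq_or_lt with h0 | h0
  · rw [← h0, mul_zero]; positivity
  · refine le_of_mul_le_mul_right ?_ (mul_pos hd h0)
    calc _ = (((d : ℝ) - k) * levelNorm w g k) ^ 2 := by ring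
      _ ≤ _ := cs
      _ ≤ levelNorm w g (k + 1) * (((d : ℝ) - k) * c * levelNorm w g k) := by gcongr
      _ = _ := by ring

/-- The averages of a function whose averages vanish on the sets of size `i` contract. -/
theorem levelNorm_contract {w F g : Finset (Fin n) → ℝ} {d : ℕ} (hw : ∀ T, 0 ≤ w T)
    (hsum : ∀ T : Finset (Fin n), ∑ i ∈ Tᶜ, w (insert i T) = ((d : ℝ) - T.card) * w T)
    (hg : ∀ T, w T * g T = F T)
    (hF : ∀ T : Finset (Fin n), ∑ i ∈ Tᶜ, F (insert i T) = ((d : ℝ) - T.card) * F T)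
    (hlc : ∀ (T : Finset (Fin n)) (v : Fin n → ℝ),
      w T * ∑ i ∈ Tᶜ, ∑ j ∈ (insert i T)ᶜ, w (insert j (insert i T)) * (v i * v j) ≤
        (∑ i ∈ Tᶜ, w (insert i T) * v i) ^ 2)
    {i : ℕ} (hi : ∀ T : Finset (Fin n), T.card = i → g T = 0) (m : ℕ) (hm : i + m < d) :
    ((d : ℝ) - (i + m)) * levelNorm w g (i + m) ≤ m * levelNorm w g (i + m + 1) ∧
    liftNorm w g (i + m + 1) ≤ ((d : ℝ) - (i + m)) * m * levelNorm w g (i + m) := by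
  have hlift : liftNorm w g (i + m + 1) ≤ ((d : ℝ) - (i + m)) * m * levelNorm w g (i + m) →
      ((d : ℝ) - (i + m)) * levelNorm w g (i + m) ≤ m * levelNorm w g (i + m + 1) := by
    intro hle
    have := levelNorm_le_of_liftNorm_le hw hg hF hm (c := m) (by positivity)
      (by push_cast; exact hle)
    push_cast at this
    exact this
  induction m with
  | zero =>
    -- All facets here have size i, where g vanishes, so the facet sums are zero.
    have hz : liftNorm w g (i + 0 + 1) ≤
        ((d : ℝ) - (i + (0 : ℕ))) * (0 : ℕ) * levelNorm w g (i + 0) := by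
      rw [Nat.cast_zero, mul_zero, zero_mul]
      refine le_of_eq (Finset.sum_eq_zero fun U hU => ?_)
      rw [Finset.sum_eq_zero, sq, mul_zero, mul_zero]
      intro j hj
      refine hi _ ?_
      rw [Finset.card_erase_of_mem hj, Finset.mem_powersetCard_univ.1 hU]
      rfl
    exact ⟨hlift hz, hz⟩
  | succ m ih =>
    have hz : liftNorm w g (i + (m + 1) + 1) ≤
        ((d : ℝ) - (i + (m + 1 : ℕ))) * (m + 1 : ℕ) * levelNorm w g (i + (m + 1)) := by
      have h1 := (ih (by omega) (fun hle => by
        have := levelNorm_le_of_liftNorm_le hw hg hF (show i + m < d by omega) (c := m)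
          (by positivity) (by push_cast; exact hle)
        push_cast at this
        exact this)).1
      have h2 := liftNorm_le hw hsum hg hF hlc (i + m)
      have hd : (0 : ℝ) < (d : ℝ) - (i + m + 1) := by
        have : ((i + (m + 1) : ℕ) : ℝ) < d := by exact_mod_cast hm
        push_cast at this
        linarith
      push_cast at h1 h2 ⊢
      rw [show i + (m + 1) + 1 = i + m + 2 from rfl, show i + (m + 1) = i + m + 1 from rfl]
      refine h2.trans ?_
      rw [show (d : ℝ) - (i + (m + 1)) = d - (i + m + 1) by ring, mul_assoc]
      -- The previous level contributes m and the diagonal term contributes 1, so the constant grows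
      -- to m + 1.
      refine mul_le_mul_of_nonneg_left ?_ hd.le
      linarith
    exact ⟨hlift hz, hz⟩

end Levels

/-! ### Spectra of reversible matrices. -/

section Reversible

variable {Ω : Type*} [Fintype Ω] [DecidableEq Ω]

/-- Conjugating by the diagonal matrix of √π makes P symmetric; the spectral theorem is then
transported back. -/
theorem exists_orthonormal_eigenbasis_of_reversible (P : Matrix Ω Ω ℝ) (π : Ω → ℝ)
    (hπ : ∀ τ, 0 < π τ) (hrev : ∀ τ σ, π τ * P τ σ = π σ * P σ τ) :
    ∃ (lam : Ω → ℝ) (v : Ω → Ω → ℝ), P.charpoly.Splits ∧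
      P.charpoly.roots = Finset.univ.val.map lam ∧ (∀ j, P.mulVec (v j) = lam j • v j) ∧
      ∀ i j, ∑ τ, π τ * (v i τ * v j τ) = if i = j then 1 else 0 := by
  have hs : ∀ τ, 0 < √(π τ) := fun τ => Real.sqrt_pos.2 (hπ τ)
  have hss : ∀ τ, √(π τ) * √(π τ) = π τ := fun τ => Real.mul_self_sqrt (hπ τ).le
  let S : Matrix Ω Ω ℝ := Matrix.of fun τ σ => √(π τ) * P τ σ / √(π σ)
  have hS : S.IsHermitian := by
    ext τ σ
    simp only [S, Matrix.conjTranspose_apply, Matrix.of_apply, star_trivial]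
    rw [div_eq_div_iff (hs _).ne' (hs _).ne']
    calc _ = (√(π σ) * √(π σ)) * P σ τ := by ring
      _ = (√(π τ) * √(π τ)) * P τ σ := by rw [hss, hss, hrev]
      _ = _ := by ring
  have hchar : P.charpoly = S.charpoly := by
    have h1 : S = Matrix.diagonal (fun τ => √(π τ)) * (P * Matrix.diagonal fun τ => (√(π τ))⁻¹) := by
      ext τ σ
      simp [S, Matrix.mul_diagonal, Matrix.diagonal_mul, div_eq_mul_inv, mul_assoc]
    have h2 : P = P * Matrix.diagonal (fun τ => (√(π τ))⁻¹) * Matrix.diagonal (fun τ => √(π τ)) := by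
      ext τ σ
      simp [Matrix.mul_diagonal, mul_assoc, inv_mul_cancel₀ (hs σ).ne']
    rw [h1, Matrix.charpoly_mul_comm, ← h2]
  refine ⟨hS.eigenvalues, fun j τ => hS.eigenvectorBasis j τ / √(π τ), ?_, ?_, ?_, ?_⟩
  · rw [hchar]; exact hS.splits_charpoly
  · rw [hchar, hS.roots_charpoly_eq_eigenvalues]; rfl
  · intro j
    funext τ
    have h := congrFun (hS.mulVec_eigenvectorBasis j) τ
    simp only [Matrix.mulVec, dotProduct, S, Matrix.of_apply, Pi.smul_apply, smul_eq_mul] at h ⊢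
    rw [mul_div_assoc', ← h, eq_div_iff (hs τ).ne', Finset.sum_mul]
    refine Finset.sum_congr rfl fun σ _ => ?_
    ring
  · intro i j
    have h := orthonormal_iff_ite.1 hS.eigenvectorBasis.orthonormal i j
    rw [← h, PiLp.inner_apply]
    refine Finset.sum_congr rfl fun τ _ => ?_
    simp only [RCLike.inner_apply, conj_trivial]
    rw [div_mul_div_comm, hss, mul_div_cancel₀ _ (hπ τ).ne', mul_comm]

theorem countP_map_univ_eq_card {Ω : Type*} [Fintype Ω] (lam : Ω → ℝ) (p : ℝ → Prop)
    [DecidablePred p] :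
    (Finset.univ.val.map lam).countP p = (Finset.univ.filter fun j => p (lam j)).card := by
  rw [Multiset.countP_map]
  rfl

/-- If the quadratic form of `P` is at most `c` times the norm on a subspace cut out by `κ` linear
equations, then at most `|κ|` eigenvalues exceed `c`. -/
theorem countP_roots_le_of_quadratic_le {κ : Type*} [Fintype κ] (P : Matrix Ω Ω ℝ) (π : Ω → ℝ)
    (hπ : ∀ τ, 0 < π τ) (hrev : ∀ τ σ, π τ * P τ σ = π σ * P σ τ) (c : ℝ)
    (L : (Ω → ℝ) →ₗ[ℝ] (κ → ℝ))
    (hL : ∀ f, L f = 0 → ∑ τ, π τ * (f τ * P.mulVec f τ) ≤ c * ∑ τ, π τ * (f τ * f τ)) :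
    P.charpoly.roots.countP (fun x => c < x) ≤ Fintype.card κ := by
  obtain ⟨lam, v, -, hroots, hv, horth⟩ := exists_orthonormal_eigenbasis_of_reversible P π hπ hrev
  rw [hroots, countP_map_univ_eq_card]
  by_contra! hlt
  set J := Finset.univ.filter fun j => c < lam j with hJ
  let M : (J → ℝ) →ₗ[ℝ] (Ω → ℝ) := Fintype.linearCombination ℝ fun j : J => v j.1
  have hker : LinearMap.ker (L ∘ₗ M) ≠ ⊥ := by
    apply LinearMap.ker_ne_bot_of_finrank_lt
    simpa using hlt
  obtain ⟨a, ha, ha0⟩ := Submodule.exists_mem_ne_zero_of_ne_bot hker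
  have hM : ∀ τ, M a τ = ∑ j, a j * v j.1 τ := fun τ => by
    simp [M, Fintype.linearCombination_apply]
  have hPM : ∀ τ, P.mulVec (M a) τ = ∑ j, a j * lam j.1 * v j.1 τ := by
    intro τ
    simp only [M, Fintype.linearCombination_apply, Matrix.mulVec_sum, Matrix.mulVec_smul, hv,
      Finset.sum_apply, Pi.smul_apply, smul_eq_mul, mul_assoc]
  have hpair : ∀ b : J → ℝ, ∑ τ, π τ * ((∑ j, a j * v j.1 τ) * ∑ j, b j * v j.1 τ) =
      ∑ j, a j * b j := by
    intro b
    simp only [Finset.sum_mul_sum]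
    simp only [Finset.mul_sum]
    rw [Finset.sum_comm]
    refine Finset.sum_congr rfl fun i _ => ?_
    rw [Finset.sum_comm]
    have : ∀ j, ∑ τ, π τ * (a i * v i.1 τ * (b j * v j.1 τ)) =
        a i * b j * if i = j then 1 else 0 := by
      intro j
      have h := horth i.1 j.1
      simp only [← Subtype.ext_iff] at h
      rw [← h, Finset.mul_sum]
      exact Finset.sum_congr rfl fun τ _ => by ring
    simp [this]
  have key := hL (M a) ha
  simp only [hPM, hM] at key
  rw [hpair, hpair, Finset.mul_sum, ← sub_nonneg, ← Finset.sum_sub_distrib] at key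
  have hneg : ∀ j ∈ (Finset.univ : Finset J), c * (a j * a j) - a j * (a j * lam j.1) ≤ 0 := by
    intro j _
    have : c < lam j.1 := (Finset.mem_filter.1 j.2).2
    nlinarith [mul_self_nonneg (a j)]
  obtain ⟨j, hj⟩ := Function.ne_iff.1 ha0
  have hjneg : c * (a j * a j) - a j * (a j * lam j.1) < 0 := by
    have : c < lam j.1 := (Finset.mem_filter.1 j.2).2
    have h2 : 0 < a j * a j := mul_self_pos.2 hj
    nlinarith
  exact absurd key (not_le.2 (Finset.sum_neg' hneg ⟨j, Finset.mem_univ j, hjneg⟩))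

theorem roots_nonneg_of_quadratic_nonneg (P : Matrix Ω Ω ℝ) (π : Ω → ℝ)
    (hπ : ∀ τ, 0 < π τ) (hrev : ∀ τ σ, π τ * P τ σ = π σ * P σ τ)
    (hP : ∀ f, 0 ≤ ∑ τ, π τ * (f τ * P.mulVec f τ)) {x : ℝ} (hx : x ∈ P.charpoly.roots) :
    0 ≤ x := by
  obtain ⟨lam, v, -, hroots, hv, horth⟩ := exists_orthonormal_eigenbasis_of_reversible P π hπ hrev
  rw [hroots, Multiset.mem_map] at hx
  obtain ⟨j, -, rfl⟩ := hx
  have h1 := hP (v j)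
  have h2 := horth j j
  rw [if_pos rfl] at h2
  rw [hv] at h1
  have : ∑ τ, π τ * (v j τ * (lam j • v j) τ) = lam j * ∑ τ, π τ * (v j τ * v j τ) := by
    rw [Finset.mul_sum]
    refine Finset.sum_congr rfl fun τ _ => ?_
    simp only [Pi.smul_apply, smul_eq_mul]
    ring
  rwa [this, h2, mul_one] at h1

theorem mem_roots_charpoly_of_mulVec_eq (P : Matrix Ω Ω ℝ) {f : Ω → ℝ} (hf : f ≠ 0) {x : ℝ}
    (h : P.mulVec f = x • f) : x ∈ P.charpoly.roots := by
  rw [Polynomial.mem_roots P.charpoly_monic.ne_zero, ← Matrix.charpoly_toLin',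
    ← Module.End.hasEigenvalue_iff_isRoot_charpoly]
  exact Module.End.hasEigenvalue_of_hasEigenvector
    ⟨Module.End.mem_eigenspace_iff.2 (by rw [Matrix.toLin'_apply, h]), hf⟩

theorem fold_max_le {s : Multiset ℝ} {b : ℝ} (hb : 0 ≤ b) (h : ∀ x ∈ s, x ≤ b) :
    s.fold max 0 ≤ b := by
  induction s using Multiset.induction_on with
  | empty => simpa using hb
  | cons a s ih =>
    rw [Multiset.fold_cons_left]
    exact max_le (h a (Multiset.mem_cons_self a s))
      (ih fun x hx => h x (Multiset.mem_cons_of_mem hx))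

/-- The eigenvalue 1 already uses up the single allowance above b. -/
theorem lambdaStar_le {P : Matrix Ω Ω ℝ} {b : ℝ} (hb : 0 ≤ b) (hb1 : b < 1)
    (hone : (1 : ℝ) ∈ P.charpoly.roots) (hnonneg : ∀ x ∈ P.charpoly.roots, 0 ≤ x)
    (hcount : P.charpoly.roots.countP (fun x => b < x) ≤ 1) : lambdaStar P ≤ b := by
  refine fold_max_le hb fun y hy => ?_
  obtain ⟨x, hx, rfl⟩ := Multiset.mem_map.1 hy
  rw [abs_of_nonneg (hnonneg x (Multiset.mem_of_mem_erase hx))]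
  by_contra! hlt
  rw [← Multiset.cons_erase hone, Multiset.countP_cons_of_pos _ hb1] at hcount
  exact absurd (Nat.le_of_succ_le_succ hcount) (not_le.2 (Multiset.countP_pos.2 ⟨x, hx, hlt⟩))

end Reversible

/-! ### From L² contraction to mixing time. -/

section Mixing

variable {Ω : Type*} [Fintype Ω] [DecidableEq Ω]

theorem pow_reversible {P : Matrix Ω Ω ℝ} {π : Ω → ℝ}
    (hrev : ∀ τ σ, π τ * P τ σ = π σ * P σ τ) (t : ℕ) (τ σ : Ω) :
    π τ * (P ^ t) τ σ = π σ * (P ^ t) σ τ := by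
  induction t generalizing τ σ with
  | zero =>
    by_cases h : τ = σ
    · rw [h]
    · simp [Matrix.one_apply_ne h, Matrix.one_apply_ne (Ne.symm h)]
  | succ t ih =>
    rw [pow_succ, Matrix.mul_apply, ← pow_succ, pow_succ', Matrix.mul_apply, Finset.mul_sum,
      Finset.mul_sum]
    refine Finset.sum_congr rfl fun ρ _ => ?_
    rw [← mul_assoc, ih, mul_right_comm, hrev]
    ring

theorem pow_mulVec_one {P : Matrix Ω Ω ℝ} (hone : P.mulVec 1 = 1) (t : ℕ) :
    (P ^ t).mulVec 1 = 1 := by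
  induction t with
  | zero => simp
  | succ t ih => rw [pow_succ, ← Matrix.mulVec_mulVec, hone, ih]

theorem sum_mul_mulVec_of_reversible {Ω : Type*} [Fintype Ω] {P : Matrix Ω Ω ℝ} {π : Ω → ℝ}
    (hrev : ∀ τ σ, π τ * P τ σ = π σ * P σ τ) (hone : P.mulVec 1 = 1) (f : Ω → ℝ) :
    ∑ τ, π τ * P.mulVec f τ = ∑ τ, π τ * f τ := by
  simp only [Matrix.mulVec, dotProduct, Finset.mul_sum]
  rw [Finset.sum_comm]
  refine Finset.sum_congr rfl fun σ _ => ?_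
  have h := congrFun hone σ
  simp only [Matrix.mulVec, dotProduct, Pi.one_apply, mul_one] at h
  calc ∑ τ, π τ * (P τ σ * f σ) = ∑ τ, (π σ * f σ) * P σ τ :=
        Finset.sum_congr rfl fun τ _ => by rw [← mul_assoc, hrev]; ring
    _ = π σ * f σ := by rw [← Finset.mul_sum, h, mul_one]

/-- A reversible chain contracting mean-zero functions by `c` converges at rate `c ^ t`. -/
theorem sq_sum_abs_pow_sub_le {P : Matrix Ω Ω ℝ} {π : Ω → ℝ} (hπ : ∀ τ, 0 < π τ)
    (hsum : ∑ τ, π τ = 1) (hrev : ∀ τ σ, π τ * P τ σ = π σ * P σ τ) (hone : P.mulVec 1 = 1)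
    (c : ℝ) (hc : ∀ f : Ω → ℝ, ∑ τ, π τ * f τ = 0 →
      ∑ τ, π τ * P.mulVec f τ ^ 2 ≤ c ^ 2 * ∑ τ, π τ * f τ ^ 2) (τ : Ω) (t : ℕ) :
    (∑ σ, |(P ^ t) τ σ - π σ|) ^ 2 ≤ (c ^ t) ^ 2 * (1 / π τ - 1) := by
  -- The density of the point mass at τ relative to π, minus 1; by reversibility its evolution is
  -- that of the density of P^t(τ, ·).
  set u : Ω → ℝ := fun σ => (if σ = τ then 1 / π τ else 0) - 1 with hu
  have hτ := (hπ τ).ne'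
  have hmean : ∑ σ, π σ * u σ = 0 := by
    simp [hu, mul_sub, hsum, hτ]
  have hnorm : ∑ σ, π σ * u σ ^ 2 = 1 / π τ - 1 := by
    have : ∀ σ, π σ * u σ ^ 2 =
        (if σ = τ then π σ * (1 / π τ ^ 2 - 2 / π τ) else 0) + π σ := by
      intro σ
      simp only [hu]
      split_ifs <;> ring
    simp only [this, Finset.sum_add_distrib, hsum, Finset.sum_ite_eq', Finset.mem_univ, if_true]
    field_simp
    ring
  have hiter : ∀ t, ∑ σ, π σ * (P ^ t).mulVec u σ = 0 ∧
      ∑ σ, π σ * (P ^ t).mulVec u σ ^ 2 ≤ (c ^ t) ^ 2 * (1 / π τ - 1) := by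
    intro t
    induction t with
    | zero => simpa using ⟨hmean, by simpa using hnorm.le⟩
    | succ t ih =>
      rw [pow_succ' P, ← Matrix.mulVec_mulVec]
      refine ⟨by rw [sum_mul_mulVec_of_reversible hrev hone, ih.1], (hc _ ih.1).trans ?_⟩
      calc _ ≤ c ^ 2 * ((c ^ t) ^ 2 * (1 / π τ - 1)) :=
            mul_le_mul_of_nonneg_left ih.2 (sq_nonneg c)
        _ = _ := by ring
  have hval : ∀ σ, (P ^ t) τ σ - π σ = π σ * (P ^ t).mulVec u σ := by
    intro σ
    have h1 : (P ^ t).mulVec u σ = (P ^ t) σ τ / π τ - 1 := by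
      have h := congrFun (pow_mulVec_one hone t) σ
      simp only [Matrix.mulVec, dotProduct, Pi.one_apply, mul_one] at h
      simp [Matrix.mulVec, dotProduct, hu, mul_sub, h, div_eq_mul_inv]
    have h2 := pow_reversible hrev t τ σ
    rw [h1, mul_sub, mul_one, mul_div_assoc', ← h2, mul_div_cancel_left₀ _ hτ]
  calc (∑ σ, |(P ^ t) τ σ - π σ|) ^ 2 ≤ (∑ σ, π σ) * ∑ σ, π σ * (P ^ t).mulVec u σ ^ 2 := by
        refine Finset.sum_sq_le_sum_mul_sum_of_sq_le_mul _ (fun σ _ => (hπ σ).le)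
          (fun σ _ => mul_nonneg (hπ σ).le (sq_nonneg _)) fun σ _ => le_of_eq ?_
        rw [sq_abs, hval]
        ring
    _ ≤ _ := by rw [hsum, one_mul]; exact (hiter t).2

theorem pow_one_sub_inv_le {d : ℕ} (hd : 1 ≤ d) {y : ℝ} (hy : 0 < y) {t : ℕ}
    (ht : (d : ℝ) * Real.log (1 / y) ≤ t) : (1 - 1 / (d : ℝ)) ^ t ≤ y := by
  have hd0 : (0 : ℝ) < d := by exact_mod_cast hd
  have h0 : 0 ≤ 1 - 1 / (d : ℝ) := by
    rw [sub_nonneg, div_le_one hd0]; exact_mod_cast hd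
  calc (1 - 1 / (d : ℝ)) ^ t ≤ Real.exp (-(1 / d)) ^ t :=
        pow_le_pow_left₀ h0 (Real.one_sub_le_exp_neg _) t
    _ = Real.exp (-(t / d)) := by rw [← Real.exp_nat_mul]; congr 1; ring
    _ ≤ Real.exp (Real.log y) := by
        rw [Real.exp_le_exp, neg_le, ← Real.log_inv, ← one_div, le_div_iff₀ hd0, mul_comm]
        exact ht
    _ = y := Real.exp_log hy

theorem exists_isMixingTime {P : Matrix Ω Ω ℝ} {π : Ω → ℝ} (hπ : ∀ τ, 0 < π τ)
    (hsum : ∑ τ, π τ = 1) (hrev : ∀ τ σ, π τ * P τ σ = π σ * P σ τ) (hone : P.mulVec 1 = 1)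
    {d : ℕ} (hd : 1 ≤ d) (hc : ∀ f : Ω → ℝ, ∑ τ, π τ * f τ = 0 →
      ∑ τ, π τ * P.mulVec f τ ^ 2 ≤ (1 - 1 / (d : ℝ)) ^ 2 * ∑ τ, π τ * f τ ^ 2)
    (τ : Ω) {ε : ℝ} (hε : 0 < ε) (hε1 : ε < 1) :
    ∃ T : ℕ, IsMixingTime P π τ ε T ∧ T ≤ ⌈(d : ℝ) * Real.log (1 / (ε * π τ))⌉₊ ∧
      (2 ≤ d → (T : ℝ) ≤ (d : ℝ) * Real.log (1 / (ε * π τ))) := by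
  have hd0 : (0 : ℝ) < d := by exact_mod_cast hd
  have hc0 : 0 ≤ 1 - 1 / (d : ℝ) := by
    rw [sub_nonneg, div_le_one hd0]; exact_mod_cast hd
  have hx := hπ τ
  have hx1 : π τ ≤ 1 := hsum ▸ Finset.single_le_sum (fun σ _ => (hπ σ).le) (Finset.mem_univ τ)
  have hy : 0 < ε * π τ := mul_pos hε hx
  have hL : 0 ≤ (d : ℝ) * Real.log (1 / (ε * π τ)) := by
    refine mul_nonneg hd0.le (Real.log_nonneg ?_)
    rw [le_div_iff₀ hy]
    nlinarith
  -- The slack factor 2 comes from 4x(1-x) ≤ 1 with x = π(τ).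
  have hbound : ∀ t : ℕ, (1 - 1 / (d : ℝ)) ^ t ≤ 2 * (ε * π τ) →
      ∑ σ, |(P ^ t) τ σ - π σ| ≤ ε := by
    intro t ht
    refine (abs_le_of_sq_le_sq'
      ((sq_sum_abs_pow_sub_le hπ hsum hrev hone _ hc τ t).trans ?_) hε.le).2
    have hone_sub : 0 ≤ 1 / π τ - 1 := by
      rw [sub_nonneg, le_div_iff₀ hx, one_mul]; exact hx1
    calc _ ≤ (2 * (ε * π τ)) ^ 2 * (1 / π τ - 1) := by
          gcongr
      _ = ε ^ 2 * (4 * (π τ * (1 - π τ))) := by field_simp; ring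
      _ ≤ ε ^ 2 * 1 := by
          refine mul_le_mul_of_nonneg_left ?_ (sq_nonneg ε)
          nlinarith [sq_nonneg (2 * π τ - 1)]
      _ = ε ^ 2 := mul_one _
  have hceil := hbound _ ((pow_one_sub_inv_le hd hy (Nat.le_ceil _)).trans (by linarith))
  classical
  have hex : ∃ t : ℕ, ∑ σ, |(P ^ t) τ σ - π σ| ≤ ε := ⟨_, hceil⟩
  refine ⟨Nat.find hex, ⟨Nat.find_spec hex, fun t ht => Nat.find_min' hex ht⟩,
    Nat.find_min' hex hceil, fun hd2 => ?_⟩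
  -- The floor suffices: one step more brings the power below ε·π(τ), and undoing it costs at most a
  -- factor 2 because 1 - 1/d ≥ 1/2.
  refine le_trans ?_ (Nat.floor_le hL)
  refine Nat.cast_le.2 (Nat.find_min' hex (hbound _ ?_))
  have h1 := pow_one_sub_inv_le hd hy (t := ⌊(d : ℝ) * Real.log (1 / (ε * π τ))⌋₊ + 1)
    (by push_cast; exact (Nat.lt_floor_add_one _).le)
  rw [pow_succ] at h1
  have hhalf : 1 / 2 ≤ 1 - 1 / (d : ℝ) := by
    have : 1 / (d : ℝ) ≤ 1 / 2 := one_div_le_one_div_of_le two_pos (by exact_mod_cast hd2)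
    linarith
  nlinarith [mul_le_mul_of_nonneg_left hhalf
    (pow_nonneg hc0 ⌊(d : ℝ) * Real.log (1 / (ε * π τ))⌋₊)]

end Mixing

/-! ### The down-up chain expressed through level norms. -/

section DownUp

variable {n : ℕ}

/-- Extension by zero of a function on the support. -/
noncomputable def extendSupp (μ : Finset (Fin n) → ℝ) (f : supp μ → ℝ) : Finset (Fin n) → ℝ :=
  fun S => if h : S ∈ supp μ then f ⟨S, h⟩ else 0

/-- The average over the sets of the support containing `T`. -/
noncomputable def upAverage (μ : Finset (Fin n) → ℝ) (f : supp μ → ℝ) : Finset (Fin n) → ℝ :=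
  fun T => upWeight (fun S => μ S * extendSupp μ f S) T / upWeight μ T

theorem mem_supp {μ : Finset (Fin n) → ℝ} {S : Finset (Fin n)} : S ∈ supp μ ↔ μ S ≠ 0 := by
  simp [supp]

theorem extendSupp_coe (μ : Finset (Fin n) → ℝ) (f : supp μ → ℝ) (σ : supp μ) :
    extendSupp μ f σ.1 = f σ := by
  simp [extendSupp]

theorem sum_mul_eq_sum_supp (μ : Finset (Fin n) → ℝ) (h : Finset (Fin n) → ℝ) :
    ∑ S, μ S * h S = ∑ σ : supp μ, μ σ.1 * h σ.1 := by
  rw [Finset.sum_coe_sort (supp μ) fun S => μ S * h S]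
  refine (Finset.sum_subset (Finset.subset_univ _) fun S _ hS => ?_).symm
  rw [mem_supp, not_not] at hS
  rw [hS, zero_mul]

theorem upWeight_extendSupp (μ : Finset (Fin n) → ℝ) (f : supp μ → ℝ) (T : Finset (Fin n)) :
    upWeight (fun S => μ S * extendSupp μ f S) T =
      ∑ σ : supp μ, if T ⊆ σ.1 then μ σ.1 * f σ else 0 := by
  have := sum_mul_eq_sum_supp μ fun S => if T ⊆ S then extendSupp μ f S else 0
  simp only [mul_ite, mul_zero, extendSupp_coe] at this
  exact this

theorem sum_filter_supp_eq_upWeight (μ : Finset (Fin n) → ℝ) (T : Finset (Fin n)) :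
    ∑ ρ ∈ (supp μ).filter (fun ρ => T ⊆ ρ), μ ρ = upWeight μ T := by
  rw [Finset.sum_filter, upWeight]
  refine Finset.sum_subset (Finset.subset_univ _) fun S _ hS => ?_
  rw [mem_supp, not_not] at hS
  simp [hS]

theorem downUp_mulVec (μ : Finset (Fin n) → ℝ) (f : supp μ → ℝ) (τ : supp μ) :
    (downUp μ).mulVec f τ = 1 / (τ.1.card : ℝ) * ∑ i ∈ τ.1, upAverage μ f (τ.1.erase i) := by
  simp only [Matrix.mulVec, dotProduct, downUp, Matrix.of_apply, Finset.sum_mul]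
  rw [Finset.sum_comm, Finset.mul_sum]
  refine Finset.sum_congr rfl fun i _ => ?_
  rw [upAverage, upWeight_extendSupp, Finset.sum_div, Finset.mul_sum]
  refine Finset.sum_congr rfl fun σ _ => ?_
  rw [sum_filter_supp_eq_upWeight]
  split_ifs <;> ring

theorem sum_erase_eq_sum_powersetCard {k : ℕ} {τ : Finset (Fin n)} (hτ : τ.card = k + 1)
    (ψ : Finset (Fin n) → ℝ) :
    ∑ i ∈ τ, ψ (τ.erase i) = ∑ T ∈ Finset.powersetCard k Finset.univ, if T ⊆ τ then ψ T else 0 := by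
  rw [← Finset.sum_filter]
  refine Finset.sum_bij (fun i _ => τ.erase i) ?_ ?_ ?_ fun _ _ => rfl
  · intro i hi
    simp [Finset.card_erase_of_mem hi, hτ, Finset.erase_subset]
  · intro i hi j hj h
    exact Finset.erase_injOn τ hi hj h
  · intro T hT
    simp only [Finset.mem_filter, Finset.mem_powersetCard_univ] at hT
    obtain ⟨i, hi, rfl⟩ := Finset.exists_eq_insert_iff.2 ⟨hT.2, by rw [hT.1, hτ]⟩
    exact ⟨i, Finset.mem_insert_self _ _, Finset.erase_insert hi⟩

theorem downUp_reversible {μ : Finset (Fin n) → ℝ} {k : ℕ}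
    (hcard : ∀ S, μ S ≠ 0 → S.card = k + 1) (τ σ : supp μ) :
    μ τ.1 * downUp μ τ σ = μ σ.1 * downUp μ σ τ := by
  -- Indexing by the common facet T instead of the dropped element makes the formula visibly
  -- symmetric in τ and σ.
  have key : ∀ τ σ : supp μ, μ τ.1 * downUp μ τ σ =
      ∑ T ∈ Finset.powersetCard k Finset.univ, if T ⊆ τ.1 then if T ⊆ σ.1 then
        1 / ((k : ℝ) + 1) * (μ τ.1 * μ σ.1) / upWeight μ T else 0 else 0 := by
    intro τ σ
    have hτ := hcard _ (mem_supp.1 τ.2)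
    rw [← sum_erase_eq_sum_powersetCard hτ fun T => if T ⊆ σ.1 then
        1 / ((k : ℝ) + 1) * (μ τ.1 * μ σ.1) / upWeight μ T else 0]
    simp only [downUp, Matrix.of_apply, sum_filter_supp_eq_upWeight, hτ, Finset.mul_sum]
    refine Finset.sum_congr rfl fun i _ => ?_
    push_cast
    split_ifs <;> ring
  rw [key, key]
  refine Finset.sum_congr rfl fun T _ => ?_
  rw [mul_comm (μ τ.1)]
  split_ifs <;> rfl

theorem downUp_mulVec_one {μ : Finset (Fin n) → ℝ} (hμ : ∀ S, 0 ≤ μ S) {k : ℕ}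
    (hcard : ∀ S, μ S ≠ 0 → S.card = k + 1) : (downUp μ).mulVec 1 = 1 := by
  funext τ
  have hτ := hcard _ (mem_supp.1 τ.2)
  have hpos : 0 < μ τ.1 := lt_of_le_of_ne (hμ _) (Ne.symm (mem_supp.1 τ.2))
  have hext : (fun S => μ S * extendSupp μ 1 S) = μ := by
    funext S
    by_cases h : μ S = 0
    · simp [h]
    · simp [extendSupp, mem_supp, h]
  have havg : ∀ i ∈ τ.1, upAverage μ 1 (τ.1.erase i) = 1 := by
    intro i _
    rw [upAverage, hext, div_self]
    refine (lt_of_lt_of_le hpos ?_).ne'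
    have := Finset.single_le_sum (f := fun S => if τ.1.erase i ⊆ S then μ S else 0)
      (fun S _ => by split_ifs <;> simp [hμ]) (Finset.mem_univ τ.1)
    simpa [Finset.erase_subset, upWeight] using this
  rw [downUp_mulVec, Finset.sum_congr rfl havg, Finset.sum_const, nsmul_one, hτ, Pi.one_apply]
  exact one_div_mul_cancel (by positivity)

/-- Identifies the top level with the state space, since weight and μ agree on sets of size d. -/
theorem sum_powersetCard_mul_eq {μ : Finset (Fin n) → ℝ} {d : ℕ}
    (hcard : ∀ S, μ S ≠ 0 → S.card = d) (h : Finset (Fin n) → ℝ) :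
    ∑ U ∈ Finset.powersetCard d Finset.univ, upWeight μ U * h U =
      ∑ τ : supp μ, μ τ.1 * h τ.1 := by
  rw [← sum_mul_eq_sum_supp]
  refine (Finset.sum_congr rfl fun U hU => ?_).trans
    (Finset.sum_subset (Finset.subset_univ _) fun S _ hS => ?_)
  · rw [upWeight_eq_self hcard (Finset.mem_powersetCard_univ.1 hU)]
  · rw [Finset.mem_powersetCard_univ] at hS
    rw [not_not.1 fun h0 => hS (hcard S h0), zero_mul]

theorem upAverage_coe {μ : Finset (Fin n) → ℝ} {d : ℕ} (hcard : ∀ S, μ S ≠ 0 → S.card = d)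
    (f : supp μ → ℝ) (τ : supp μ) : upAverage μ f τ.1 = f τ := by
  have hτ := mem_supp.1 τ.2
  rw [upAverage, upWeight_eq_self hcard (hcard _ hτ),
    upWeight_eq_self (fun S hS => hcard S (left_ne_zero_of_mul hS)) (hcard _ hτ),
    extendSupp_coe, mul_div_cancel_left₀ _ hτ]

theorem downUp_quadratic {μ : Finset (Fin n) → ℝ} (hμ : ∀ S, 0 ≤ μ S) {k : ℕ}
    (hcard : ∀ S, μ S ≠ 0 → S.card = k + 1) (f : supp μ → ℝ) :
    ∑ τ : supp μ, μ τ.1 * (f τ * (downUp μ).mulVec f τ) =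
      1 / ((k : ℝ) + 1) * levelNorm (upWeight μ) (upAverage μ f) k := by
  have hcard' : ∀ S, μ S * extendSupp μ f S ≠ 0 → S.card = k + 1 := fun S hS =>
    hcard S (left_ne_zero_of_mul hS)
  have h := levelNorm_pairing (w := upWeight μ)
    (F := upWeight fun S => μ S * extendSupp μ f S) (g := upAverage μ f) (d := k + 1)
    (fun T => mul_div_cancel_of_imp' fun h => upWeight_mul_eq_zero hμ _ h)
    (sum_upWeight_insert hcard') k
  rw [sum_powersetCard_mul_eq hcard] at h
  have hk : ((k + 1 : ℕ) : ℝ) - k = 1 := by push_cast; ring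
  rw [hk, one_mul] at h
  rw [← h, Finset.mul_sum]
  refine Finset.sum_congr rfl fun τ _ => ?_
  rw [downUp_mulVec, upAverage_coe hcard, hcard _ (mem_supp.1 τ.2)]
  push_cast
  ring

theorem downUp_quadratic_nonneg {μ : Finset (Fin n) → ℝ} (hμ : ∀ S, 0 ≤ μ S) {k : ℕ}
    (hcard : ∀ S, μ S ≠ 0 → S.card = k + 1) (f : supp μ → ℝ) :
    0 ≤ ∑ τ : supp μ, μ τ.1 * (f τ * (downUp μ).mulVec f τ) := by
  rw [downUp_quadratic hμ hcard]
  exact mul_nonneg (by positivity) (levelNorm_nonneg (upWeight_nonneg hμ) _ _)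

/-- The down-up chain contracts the functions whose sums over the supports of the sets of size `i`
vanish. -/
theorem downUp_contract {μ : Finset (Fin n) → ℝ} (hμ : ∀ S, 0 ≤ μ S) {d : ℕ}
    (hcard : ∀ S, μ S ≠ 0 → S.card = d) (hslc : StronglyLogConcave (genPoly μ)) {i : ℕ}
    (hi : i < d) (f : supp μ → ℝ)
    (hf : ∀ T : Finset (Fin n), T.card = i →
      ∑ σ : supp μ, (if T ⊆ σ.1 then μ σ.1 * f σ else 0) = 0) :
    ∑ τ : supp μ, μ τ.1 * (f τ * (downUp μ).mulVec f τ) ≤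
        (1 - ((i : ℝ) + 1) / d) * ∑ τ : supp μ, μ τ.1 * (f τ * f τ) ∧
    ∑ τ : supp μ, μ τ.1 * (downUp μ).mulVec f τ ^ 2 ≤
        (1 - ((i : ℝ) + 1) / d) ^ 2 * ∑ τ : supp μ, μ τ.1 * f τ ^ 2 := by
  -- Here m = d - 1 - i, so m/d is exactly 1 - (i+1)/d.
  obtain ⟨m, rfl⟩ := Nat.exists_eq_add_of_lt hi
  have hcard' : ∀ S, μ S * extendSupp μ f S ≠ 0 → S.card = i + m + 1 := fun S hS =>
    hcard S (left_ne_zero_of_mul hS)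
  have hcon := levelNorm_contract (w := upWeight μ)
    (F := upWeight fun S => μ S * extendSupp μ f S) (g := upAverage μ f) (d := i + m + 1)
    (upWeight_nonneg hμ) (sum_upWeight_insert hcard)
    (fun T => mul_div_cancel_of_imp' fun h => upWeight_mul_eq_zero hμ _ h)
    (sum_upWeight_insert hcard') (logConcave_upWeight hμ hslc) (i := i)
    (fun T hT => by rw [upAverage, upWeight_extendSupp, hf T hT, zero_div]) m (Nat.lt_succ_self _)
  have h1 : ((i + m + 1 : ℕ) : ℝ) - (i + m) = 1 := by push_cast; ring
  rw [h1, one_mul, one_mul] at hcon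
  obtain ⟨hlevel, hlift⟩ := hcon
  have htop : levelNorm (upWeight μ) (upAverage μ f) (i + m + 1) =
      ∑ τ : supp μ, μ τ.1 * f τ ^ 2 := by
    rw [levelNorm, sum_powersetCard_mul_eq hcard fun U => upAverage μ f U ^ 2]
    simp only [upAverage_coe hcard]
  rw [htop] at hlevel
  have hd : (0 : ℝ) < (i : ℝ) + m + 1 := by positivity
  have hcoef : 1 - ((i : ℝ) + 1) / ((i + m + 1 : ℕ) : ℝ) = m / ((i : ℝ) + m + 1) := by
    push_cast
    field_simp
    ring
  have hsq : ∑ τ : supp μ, μ τ.1 * (downUp μ).mulVec f τ ^ 2 =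
      (1 / ((i : ℝ) + m + 1)) ^ 2 * liftNorm (upWeight μ) (upAverage μ f) (i + m + 1) := by
    rw [liftNorm, sum_powersetCard_mul_eq hcard
      fun U => (∑ j ∈ U, upAverage μ f (U.erase j)) ^ 2, Finset.mul_sum]
    refine Finset.sum_congr rfl fun τ _ => ?_
    rw [downUp_mulVec, hcard _ (mem_supp.1 τ.2), mul_pow]
    push_cast
    ring
  rw [hcoef]
  constructor
  · rw [downUp_quadratic hμ hcard]
    simp only [← sq]
    push_cast
    rw [div_mul_eq_mul_div, div_mul_eq_mul_div, one_mul]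
    gcongr
  · rw [hsq, one_div_pow, div_pow, div_mul_eq_mul_div, div_mul_eq_mul_div, one_mul]
    gcongr
    calc _ ≤ _ := hlift
      _ ≤ (m : ℝ) * (m * ∑ τ : supp μ, μ τ.1 * f τ ^ 2) := by gcongr
      _ = _ := by ring

theorem card_faces_le (μ : Finset (Fin n) → ℝ) (k : ℕ) : (faces μ k).card ≤ n.choose k := by
  calc (faces μ k).card ≤ (Finset.powersetCard k (Finset.univ : Finset (Fin n))).card :=
        Finset.card_le_card fun T hT => Finset.mem_powersetCard_univ.2 (Finset.mem_filter.1 hT).2.1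
    _ = n.choose k := by simp

theorem countP_roots_downUp_le {μ : Finset (Fin n) → ℝ} (hμ : ∀ S, 0 ≤ μ S) {d : ℕ}
    (hcard : ∀ S, μ S ≠ 0 → S.card = d) (hslc : StronglyLogConcave (genPoly μ)) {k : ℕ}
    (hk : k < d) :
    (downUp μ).charpoly.roots.countP (fun x => 1 - ((k : ℝ) + 1) / d < x) ≤ (faces μ k).card := by
  obtain ⟨e, rfl⟩ : ∃ e, d = e + 1 := ⟨d - 1, by omega⟩
  let L : (supp μ → ℝ) →ₗ[ℝ] (faces μ k → ℝ) :=
    { toFun := fun f T => ∑ σ : supp μ, if T.1 ⊆ σ.1 then μ σ.1 * f σ else 0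
      map_add' := fun f g => by
        funext T
        simp only [Pi.add_apply, ← Finset.sum_add_distrib]
        refine Finset.sum_congr rfl fun σ _ => ?_
        split_ifs <;> ring
      map_smul' := fun c f => by
        funext T
        simp only [Pi.smul_apply, smul_eq_mul, RingHom.id_apply, Finset.mul_sum]
        refine Finset.sum_congr rfl fun σ _ => ?_
        split_ifs <;> ring }
  rw [← Fintype.card_coe]
  refine countP_roots_le_of_quadratic_le (downUp μ) (fun σ => μ σ.1)
    (fun σ => lt_of_le_of_ne (hμ _) (Ne.symm (mem_supp.1 σ.2))) (downUp_reversible hcard) _ L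
    fun f hf => (downUp_contract hμ hcard hslc hk f fun T hT => ?_).1
  -- Outside X(k) the condition is an empty sum, so |X(k)| equations suffice.
  by_cases hTf : T ∈ faces μ k
  · exact congrFun hf ⟨T, hTf⟩
  · refine Finset.sum_eq_zero fun σ _ => if_neg fun hTσ => hTf ?_
    exact Finset.mem_filter.2 ⟨Finset.mem_univ _, hT, σ.1, σ.2, hTσ⟩

end DownUp

theorem theorem1p1 (n d : ℕ) (hd : 1 ≤ d) (μ : Finset (Fin n) → ℝ)
    (hdist : IsDistribution μ)
    (hhom : (genPoly μ).IsHomogeneous d)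
    (hslc : StronglyLogConcave (genPoly μ)) :
    (downUp μ).charpoly.Splits ∧
    (∀ k : ℕ, k ≤ d - 1 →
      (eigenvalueMultiset (downUp μ)).countP
          (fun x => 1 - ((k : ℝ) + 1) / (d : ℝ) < x) ≤ (faces μ k).card ∧
      (faces μ k).card ≤ n.choose k) ∧
    1 / (d : ℝ) ≤ spectralGap (downUp μ) ∧
    (∀ (τ : supp μ) (ε : ℝ), 0 < ε → ε < 1 →
      ∃ T : ℕ, IsMixingTime (downUp μ) (fun σ : supp μ => μ σ.1) τ ε T ∧
        T ≤ ⌈(d : ℝ) * Real.log (1 / (ε * μ τ.1))⌉₊ ∧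
        (2 ≤ d → (T : ℝ) ≤ (d : ℝ) * Real.log (1 / (ε * μ τ.1)))) := by
  obtain ⟨hμ, htotal⟩ := hdist
  have hcard : ∀ S, μ S ≠ 0 → S.card = d := fun S hS => card_eq_of_isHomogeneous hhom hS
  obtain ⟨e, he⟩ : ∃ e, d = e + 1 := ⟨d - 1, by omega⟩
  have hcard' : ∀ S, μ S ≠ 0 → S.card = e + 1 := he ▸ hcard
  have hpos : ∀ σ : supp μ, 0 < μ σ.1 := fun σ =>
    lt_of_le_of_ne (hμ _) (Ne.symm (mem_supp.1 σ.2))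
  have hrev := downUp_reversible hcard'
  have hone := downUp_mulVec_one hμ hcard'
  have hsum : ∑ σ : supp μ, μ σ.1 = 1 := by
    rw [← htotal]
    simpa using (sum_mul_eq_sum_supp μ fun _ => 1).symm
  have hd0 : (0 : ℝ) < d := by exact_mod_cast hd
  have hcount : ∀ k : ℕ, k ≤ d - 1 → (downUp μ).charpoly.roots.countP
      (fun x => 1 - ((k : ℝ) + 1) / (d : ℝ) < x) ≤ (faces μ k).card := fun k hk =>
    countP_roots_downUp_le hμ hcard hslc (by omega)
  obtain ⟨-, -, hsplits, -⟩ := exists_orthonormal_eigenbasis_of_reversible _ _ hpos hrev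
  refine ⟨hsplits, fun k hk => ⟨hcount k hk, card_faces_le μ k⟩, ?_, fun τ ε hε hε1 => ?_⟩
  · have hstar : lambdaStar (downUp μ) ≤ 1 - 1 / d := by
      refine lambdaStar_le ?_ (by linarith [one_div_pos.2 hd0]) ?_
        (fun x => roots_nonneg_of_quadratic_nonneg _ _ hpos hrev
          (downUp_quadratic_nonneg hμ hcard')) ?_
      · rw [sub_nonneg, div_le_one hd0]; exact_mod_cast hd
      · refine mem_roots_charpoly_of_mulVec_eq _ (f := 1) ?_ (by rw [hone, one_smul])
        intro h
        have : ∀ σ : supp μ, False := fun σ => one_ne_zero (congrFun h σ)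
        rw [Finset.sum_eq_zero fun σ _ => (this σ).elim] at hsum
        exact zero_ne_one hsum
      · have := (hcount 0 (Nat.zero_le _)).trans (card_faces_le μ 0)
        simpa using this
    rw [spectralGap]
    linarith
  · refine exists_isMixingTime (π := fun σ : supp μ => μ σ.1) hpos hsum hrev hone hd
      (fun f hf => ?_) τ hε hε1
    have := (downUp_contract hμ hcard hslc (i := 0) hd f fun T hT => ?_).2
    · simpa using this
    -- For T = ∅ the vanishing condition is precisely that f has mean zero.
    · rw [Finset.card_eq_zero.1 hT]
      simpa using hf
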